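/- Theorem 1.1. An overpartition of a non-negative integer $n$ is a partition of $n$ in which the first occurrence of each part size may be overlined. For $\ell\ge 2$, let $\overline{R_\ell^\ast}(n)$ denote the number of overpartitions of $n$ none of whose non-overlined parts is divisible by $\ell$. Then for all $n\ge 0$, $$\overline{R_3^\ast}(9n+4)\equiv 0\pmod{12},\qquad \overline{R_3^\ast}(9n+7)\equiv 0\pmod{48},$$ $$\overline{R_6^\ast}(9n+5)\equiv 0\pmod{24},\qquad \overline{R_6^\ast}(9n+8)\equiv 0\pmod{96}.$$ -/

import Mathlib

/-- An overpartition of `n`: a partition of `n` in which the first occurrence of each part size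
may be overlined. It is recorded as the underlying partition together with the set of those part
sizes whose first occurrence is overlined. -/
structure Overpartition (n : ℕ) where
  partition : n.Partition
  overlined : Finset ℕ
  overlined_subset : overlined ⊆ partition.parts.toFinset

namespace Overpartition

/-- An overpartition is a pair of a partition and a subset of its set of part sizes. -/
def equivSigma (n : ℕ) :
    Overpartition n ≃ Σ p : n.Partition, {s : Finset ℕ // s ∈ p.parts.toFinset.powerset} where
  toFun π := ⟨π.partition, π.overlined, Finset.mem_powerset.mpr π.overlined_subset⟩
  invFun x := ⟨x.1, x.2.1, Finset.mem_powerset.mp x.2.2⟩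
  left_inv _ := rfl
  right_inv _ := rfl

instance (n : ℕ) : Fintype (Overpartition n) :=
  Fintype.ofEquiv _ (equivSigma n).symm

/-- The multiset of non-overlined parts: all parts, with one copy of each overlined size removed. -/
def nonOverlined {n : ℕ} (π : Overpartition n) : Multiset ℕ :=
  π.partition.parts - π.overlined.val

end Overpartition

/-- A multiset of parts is `ℓ`-regular if none of the parts is divisible by `ℓ`. -/
def IsRegularParts (ℓ : ℕ) (s : Multiset ℕ) : Prop :=
  ∀ i ∈ s, ¬ ℓ ∣ i

instance (ℓ : ℕ) (s : Multiset ℕ) : Decidable (IsRegularParts ℓ s) :=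
  inferInstanceAs (Decidable (∀ i ∈ s, ¬ ℓ ∣ i))

/-- The number of overpartitions of `n` whose non-overlined parts are `ℓ`-regular. -/
def RbarStar (ℓ n : ℕ) : ℕ :=
  Fintype.card {π : Overpartition n // IsRegularParts ℓ π.nonOverlined}

/-! Write f_k = ∏ (1 - q^(k i)) and φ(-q) = f_1²/f_2 = `theta 1 1`. Overlined parts contribute
f_2/f_1 and the others f_ℓ/f_1, so the generating function is f_ℓ/φ(-q). Sorting the squares in φ by
residue mod 3 gives φ(-q) = a - 2qb with a = φ(-q^9), b = Ω(q³), where Ω = `theta 1 5` = f_1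
f_6²/(f_2 f_3). With N = `thetaNorm`, N(q³) = a³ - 8q³b³ = φ(-q)(a² + 2qab + 4q²b²), so for 3 ∣ ℓ
the classes mod 3 of f_ℓ/φ can be read off.

After the product for Ω is inserted, class 1 for ℓ = 3 and class 2 for ℓ = 6 both have the form c
φ(-q) S(q³)/N(q), with c = 2 and c = 4. The second extraction needs only N ≡ φ(-q) mod 3 and N ≡
φ(-q³)³ mod 8. Modulo 3 the cofactor of c is a series in q³, so its classes 1 and 2 vanish. Modulo 8
it is φ(-q) times a series in q³; no square is 2 mod 3, so class 2 vanishes, and class 1 is even.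
This gives 6c and 24c. The product formulas for φ and Ω are cases of the Jacobi triple product, the
limit of a finite identity. -/

open PowerSeries

/-! ### Gaussian binomials and the q-binomial theorem -/

section GaussBinom

variable {R : Type*} [CommRing R]

/-- The Gaussian binomial coefficient `[n, k]_q`. -/
def gaussBinom (q : R) : ℕ → ℕ → R
  | _, 0 => 1
  | 0, _ + 1 => 0
  | n + 1, k + 1 => gaussBinom q n k + q ^ (k + 1) * gaussBinom q n (k + 1)

@[simp]
theorem gaussBinom_zero_right (q : R) (n : ℕ) : gaussBinom q n 0 = 1 := by
  cases n <;> rfl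

theorem gaussBinom_succ_succ (q : R) (n k : ℕ) :
    gaussBinom q (n + 1) (k + 1) = gaussBinom q n k + q ^ (k + 1) * gaussBinom q n (k + 1) := rfl

theorem gaussBinom_eq_zero_of_lt (q : R) {n k : ℕ} (h : n < k) : gaussBinom q n k = 0 := by
  induction n generalizing k with
  | zero => obtain ⟨k, rfl⟩ := Nat.exists_eq_succ_of_ne_zero h.ne'; rfl
  | succ n ih =>
    obtain ⟨k, rfl⟩ := Nat.exists_eq_succ_of_ne_zero (Nat.ne_zero_of_lt h)
    rw [Nat.succ_eq_add_one, gaussBinom_succ_succ, ih (by omega), ih (by omega)]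
    simp

/-- The finite `q`-Pochhammer symbol `(q; q)_n`. -/
def qFactorial (q : R) (n : ℕ) : R := ∏ i ∈ Finset.range n, (1 - q ^ (i + 1))

theorem qFactorial_succ (q : R) (n : ℕ) :
    qFactorial q (n + 1) = qFactorial q n * (1 - q ^ (n + 1)) :=
  Finset.prod_range_succ _ _

theorem gaussBinom_self (q : R) (n : ℕ) : gaussBinom q n n = 1 := by
  induction n with
  | zero => rfl
  | succ n ih => rw [gaussBinom_succ_succ, ih, gaussBinom_eq_zero_of_lt q n.lt_succ_self]; simp

/-- The quotient formula (q)_(a+b) / ((q)_a (q)_b), kept free of division so that it holds in any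
commutative ring. -/
theorem gaussBinom_mul_qFactorial (q : R) (a b : ℕ) :
    gaussBinom q (a + b) a * (qFactorial q a * qFactorial q b) = qFactorial q (a + b) := by
  induction hn : a + b generalizing a b with
  | zero =>
    obtain ⟨rfl, rfl⟩ : a = 0 ∧ b = 0 := by omega
    simp [qFactorial]
  | succ n ih =>
    rcases a with _ | a
    · obtain rfl : b = n + 1 := by omega
      simp [qFactorial]
    rcases b with _ | b
    · obtain rfl : a = n := by omega
      rw [gaussBinom_self]
      simp [qFactorial]
    have h1 := ih a (b + 1) (by omega)
    have h2 := ih (a + 1) b (by omega)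
    obtain rfl : n = a + b + 1 := by omega
    rw [gaussBinom_succ_succ, qFactorial_succ q (a + b + 1)]
    rw [qFactorial_succ] at h1 h2 ⊢
    rw [qFactorial_succ]
    -- Uses 1 - q^(a+b+2) = (1 - q^(a+1)) + q^(a+1) (1 - q^(b+1)).
    linear_combination (1 - q ^ (a + 1)) * h1 + q ^ (a + 1) * (1 - q ^ (b + 1)) * h2

/-- The `q`-binomial theorem. -/
theorem prod_add_mul_pow_eq_sum_gaussBinom (q y z : R) (n : ℕ) :
    ∏ k ∈ Finset.range n, (y + z * q ^ k) =
      ∑ j ∈ Finset.range (n + 1), gaussBinom q n j * q ^ j.choose 2 * z ^ j * y ^ (n - j) := by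
  induction n generalizing z with
  | zero => simp
  | succ n ih =>
    -- Removing the factor k = 0 leaves the same product with z replaced by zq.
    have h := ih (z * q)
    rw [Finset.prod_range_succ']
    have h' : ∏ k ∈ Finset.range n, (y + z * q ^ (k + 1)) =
        ∏ k ∈ Finset.range n, (y + z * q * q ^ k) :=
      Finset.prod_congr rfl fun k _ ↦ by ring
    rw [h', h, mul_add, Finset.sum_mul, Finset.sum_mul, Finset.sum_range_succ' _ (n + 1),
      Finset.sum_range_succ' _ n]
    have e1 : ∑ k ∈ Finset.range (n + 1), gaussBinom q (n + 1) (k + 1) * q ^ (k + 1).choose 2 *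
          z ^ (k + 1) * y ^ (n + 1 - (k + 1)) =
        ∑ k ∈ Finset.range (n + 1), gaussBinom q n k * q ^ k.choose 2 * (z * q) ^ k *
          y ^ (n - k) * (z * q ^ 0) +
        ∑ k ∈ Finset.range n, gaussBinom q n (k + 1) * q ^ (k + 1).choose 2 * (z * q) ^ (k + 1) *
          y ^ (n - (k + 1)) * y := by
      have e2 : ∑ k ∈ Finset.range n, gaussBinom q n (k + 1) * q ^ (k + 1).choose 2 *
            (z * q) ^ (k + 1) * y ^ (n - (k + 1)) * y =
          ∑ k ∈ Finset.range (n + 1), gaussBinom q n (k + 1) * q ^ (k + 1).choose 2 *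
            (z * q) ^ (k + 1) * y ^ (n - k) := by
        rw [Finset.sum_range_succ, gaussBinom_eq_zero_of_lt q n.lt_succ_self]
        simp only [zero_mul, add_zero]
        refine Finset.sum_congr rfl fun k hk ↦ ?_
        rw [show n - k = n - (k + 1) + 1 by have := Finset.mem_range.mp hk; omega]
        ring
      rw [e2, ← Finset.sum_add_distrib]
      refine Finset.sum_congr rfl fun k _ ↦ ?_
      rw [gaussBinom_succ_succ, Nat.choose_succ_succ' k 1, Nat.choose_one_right,
        Nat.add_sub_add_right]
      ring
    rw [e1]
    simp
    ring

end GaussBinom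

/-! ### Finite Jacobi triple product -/

theorem choose_two_add (a b : ℕ) : (a + b).choose 2 = a.choose 2 + b.choose 2 + a * b := by
  induction b with
  | zero => simp
  | succ b ih =>
    rw [← add_assoc, Nat.choose_succ_succ' _ 1, Nat.choose_succ_succ' _ 1, ih]
    simp
    ring

/-- The finite form of the Jacobi triple product identity. -/
theorem prod_one_sub_mul_one_sub_eq_sum_gaussBinom {R : Type*} [CommRing R] [IsDomain R]
    {u v : R} (hu : u ≠ 0) (hv : v ≠ 0) (n : ℕ) :
    ∏ i ∈ Finset.range n, ((1 - u * (u * v) ^ i) * (1 - v * (u * v) ^ i)) =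
      gaussBinom (u * v) (2 * n) n + ∑ m ∈ Finset.range n, (-1) ^ (m + 1) *
        (gaussBinom (u * v) (2 * n) (n + (m + 1)) *
            (u ^ (m + 1).choose 2 * v ^ (m + 2).choose 2) +
          gaussBinom (u * v) (2 * n) (n - (m + 1)) *
            (v ^ (m + 1).choose 2 * u ^ (m + 2).choose 2)) := by
  set q := u * v with hq
  have hq0 : q ≠ 0 := mul_ne_zero hu hv
  -- For k < n, u q^n - q^(k+1) = -q^(k+1) (1 - u q^(n-1-k)); for k = n + x it is u q^n (1 - v q^x),
  -- since q = uv. K collects the monomials pulled out.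
  set K : R := (-1) ^ n * q ^ (n + 1).choose 2 * (u * q ^ n) ^ n with hK
  have hK0 : K ≠ 0 := by
    refine mul_ne_zero (mul_ne_zero (by simp) (pow_ne_zero _ hq0)) (pow_ne_zero _ ?_)
    exact mul_ne_zero hu (pow_ne_zero _ hq0)
  have hprod : ∏ k ∈ Finset.range (2 * n), (u * q ^ n + -q * q ^ k) =
      K * ∏ i ∈ Finset.range n, ((1 - u * q ^ i) * (1 - v * q ^ i)) := by
    rw [two_mul, Finset.prod_range_add, ← Finset.prod_range_reflect]
    have h1 : ∏ j ∈ Finset.range n, (u * q ^ n + -q * q ^ (n - 1 - j)) =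
        (-1) ^ n * q ^ (n + 1).choose 2 * ∏ i ∈ Finset.range n, (1 - u * q ^ i) := by
      have : ∏ j ∈ Finset.range n, (-q ^ (n - j)) = (-1) ^ n * q ^ (n + 1).choose 2 := by
        rw [← Finset.prod_range_reflect]
        clear hK0 hK K
        induction n with
        | zero => simp
        | succ n ih =>
          rw [Finset.prod_range_succ]
          have : ∏ x ∈ Finset.range n, -q ^ (n + 1 - (n + 1 - 1 - x)) =
              ∏ x ∈ Finset.range n, -q ^ (n - (n - 1 - x)) :=
            Finset.prod_congr rfl fun x hx ↦ by
              rw [show n + 1 - (n + 1 - 1 - x) = n - (n - 1 - x) by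
                have := Finset.mem_range.mp hx; omega]
          rw [this, ih, Nat.choose_succ_succ' (n + 1) 1, Nat.choose_one_right]
          simp
          ring
      rw [← this, ← Finset.prod_mul_distrib]
      refine Finset.prod_congr rfl fun j hj ↦ ?_
      have hj := Finset.mem_range.mp hj
      obtain ⟨k, rfl⟩ : ∃ k, n = j + 1 + k := ⟨n - (j + 1), by omega⟩
      rw [show j + 1 + k - 1 - j = k by omega, show j + 1 + k - j = k + 1 by omega]
      ring
    have h2 : ∏ x ∈ Finset.range n, (u * q ^ n + -q * q ^ (n + x)) =
        (u * q ^ n) ^ n * ∏ i ∈ Finset.range n, (1 - v * q ^ i) := by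
      have hc : ∏ _x ∈ Finset.range n, (u * q ^ n) = (u * q ^ n) ^ n := by simp
      rw [← hc, ← Finset.prod_mul_distrib]
      refine Finset.prod_congr rfl fun j _ ↦ ?_
      rw [pow_add]
      linear_combination (-q ^ n * q ^ j) * hq
    rw [h1, h2, Finset.prod_mul_distrib, hK]
    ring
  apply mul_left_cancel₀ hK0
  -- The sum is cut at its central index n; the terms at distance m + 1 on either side are then
  -- paired.
  rw [← hprod, prod_add_mul_pow_eq_sum_gaussBinom, show 2 * n + 1 = n + 1 + n by ring,
    Finset.sum_range_add, Finset.sum_range_succ, ← Finset.sum_range_reflect, mul_add,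
    Finset.mul_sum]
  have hpos (m : ℕ) (hm : m < n) : q ^ (n + 1 + m).choose 2 * (-q) ^ (n + 1 + m) *
      (u * q ^ n) ^ (2 * n - (n + 1 + m)) =
      K * ((-1) ^ (m + 1) * (u ^ (m + 1).choose 2 * v ^ (m + 2).choose 2)) := by
    obtain ⟨k, rfl⟩ : ∃ k, n = m + 1 + k := ⟨n - (m + 1), by omega⟩
    rw [show 2 * (m + 1 + k) - (m + 1 + k + 1 + m) = k by omega, neg_pow, hK]
    have e : (m + 1 + k + 1 + m).choose 2 + (m + 1 + k + 1 + m) =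
        (m + 1 + k + 1).choose 2 + (m + 1 + k) * (m + 1) + (m + 2).choose 2 := by
      have h1 := choose_two_add (m + 1 + k + 1) (m + 1)
      have h2 := choose_two_add (m + 1) 1
      have h3 := choose_two_add (m + 1 + k + 1 + m) 1
      simp at h2 h3
      rw [show m + 2 = m + 1 + 1 by rfl, h2]
      rw [show m + 1 + k + 1 + (m + 1) = m + 1 + k + 1 + m + 1 by ring, h3] at h1
      linarith
    have e2 : (m + 2).choose 2 = (m + 1).choose 2 + (m + 1) := by
      simpa using choose_two_add (m + 1) 1
    calc _ = (-1) ^ (m + 1 + k + 1 + m) * q ^ ((m + 1 + k + 1 + m).choose 2 +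
          (m + 1 + k + 1 + m)) * (u * q ^ (m + 1 + k)) ^ k := by ring
      _ = (-1) ^ (m + 1 + k + 1 + m) * q ^ (m + 1 + k + 1).choose 2 * q ^ ((m + 1 + k) * (m + 1)) *
          (u ^ (m + 2).choose 2 * v ^ (m + 2).choose 2) * (u * q ^ (m + 1 + k)) ^ k := by
        rw [e, ← mul_pow, ← hq]; ring
      _ = _ := by rw [e2]; ring
  have hneg (m : ℕ) (hm : m < n) : q ^ (n - 1 - m).choose 2 * (-q) ^ (n - 1 - m) *
      (u * q ^ n) ^ (2 * n - (n - 1 - m)) =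
      K * ((-1) ^ (m + 1) * (v ^ (m + 1).choose 2 * u ^ (m + 2).choose 2)) := by
    obtain ⟨k, rfl⟩ : ∃ k, n = m + 1 + k := ⟨n - (m + 1), by omega⟩
    rw [show m + 1 + k - 1 - m = k by omega,
      show 2 * (m + 1 + k) - k = (m + 1 + k) + (m + 1) by omega, neg_pow, hK]
    have e : k.choose 2 + k + (m + 1 + k) * (m + 1) =
        (m + 1 + k + 1).choose 2 + (m + 1).choose 2 := by
      have h1 := choose_two_add (k + 1) (m + 1)
      have h2 := choose_two_add (m + 1) 1
      have h3 := choose_two_add k 1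
      simp at h2 h3
      have h4 : (m + 1) * (m + 1) = 2 * (m + 1).choose 2 + (m + 1) := by
        clear * -
        induction m with
        | zero => rfl
        | succ m ih => have := choose_two_add (m + 1) 1; simp at this; rw [this]; linarith
      rw [show m + 1 + k + 1 = k + 1 + (m + 1) by ring, h1, h3]
      linarith
    have e2 : (m + 2).choose 2 = (m + 1).choose 2 + (m + 1) := by
      simpa using choose_two_add (m + 1) 1
    have e3 : ((-1 : R)) ^ (m + 1) * (-1) ^ (m + 1) = 1 := by rw [← mul_pow]; simp
    calc _ = (-1) ^ k * q ^ (k.choose 2 + k + (m + 1 + k) * (m + 1)) * u ^ (m + 1) *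
          (u * q ^ (m + 1 + k)) ^ (m + 1 + k) := by ring
      _ = (-1) ^ k * q ^ (m + 1 + k + 1).choose 2 * (u ^ (m + 1).choose 2 * v ^ (m + 1).choose 2) *
          u ^ (m + 1) * (u * q ^ (m + 1 + k)) ^ (m + 1 + k) := by
        rw [e, ← mul_pow, ← hq]; ring
      _ = (-1) ^ k * ((-1) ^ (m + 1) * (-1) ^ (m + 1)) * q ^ (m + 1 + k + 1).choose 2 *
          (v ^ (m + 1).choose 2 * u ^ (m + 2).choose 2) *
          (u * q ^ (m + 1 + k)) ^ (m + 1 + k) := by rw [e2, e3]; ring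
      _ = _ := by ring
  have hmid : q ^ n.choose 2 * (-q) ^ n * (u * q ^ n) ^ (2 * n - n) = K := by
    have := choose_two_add n 1
    simp at this
    rw [show 2 * n - n = n by omega, neg_pow, hK, this]
    ring
  have hs : ∀ a b c : R, a + b + c = b + (c + a) := fun a b c ↦ by ring
  rw [hs]
  congr 1
  · rw [← hmid]; ring
  · rw [← Finset.sum_add_distrib]
    refine Finset.sum_congr rfl fun m hm ↦ ?_
    have hm := Finset.mem_range.mp hm
    rw [show n - (m + 1) = n - 1 - m by omega, show n + (m + 1) = n + 1 + m by ring]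
    linear_combination gaussBinom q (2 * n) (n + 1 + m) * hpos m hm +
      gaussBinom q (2 * n) (n - 1 - m) * hneg m hm

/-! ### Coefficientwise limits and infinite products -/

section Limits

open Filter Topology
open scoped PowerSeries.WithPiTopology

theorem continuous_expand (k : ℕ) (hk : k ≠ 0) :
    Continuous (expand k hk : ℤ⟦X⟧ → ℤ⟦X⟧) := by
  refine continuous_iff_continuousAt.mpr fun f ↦
    (WithPiTopology.tendsto_iff_coeff_tendsto _ _ _ _).mpr fun d ↦ ?_
  simp_rw [coeff_expand]
  split_ifs
  · exact (WithPiTopology.continuous_coeff ℤ _).tendsto f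
  · exact tendsto_const_nhds

theorem tendsto_of_X_pow_dvd_sub {a b : ℕ → ℤ⟦X⟧} {l : ℤ⟦X⟧}
    (h : ∀ n, X ^ (n + 1) ∣ a n - b n) (ha : Tendsto a atTop (𝓝 l)) :
    Tendsto b atTop (𝓝 l) := by
  rw [WithPiTopology.tendsto_iff_coeff_tendsto] at ha ⊢
  refine fun d ↦ (ha d).congr' ?_
  filter_upwards [eventually_ge_atTop d] with n hn
  have := X_pow_dvd_iff.mp (h n) d (by omega)
  rwa [map_sub, sub_eq_zero] at this

theorem coeff_eq_of_X_pow_dvd_sub {s : ℕ → ℤ⟦X⟧} (h : ∀ n, X ^ (n + 1) ∣ s (n + 1) - s n)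
    {d n : ℕ} (hn : d ≤ n) : coeff d (s n) = coeff d (s d) := by
  induction n, hn using Nat.le_induction with
  | base => rfl
  | succ n hn ih =>
    have := X_pow_dvd_iff.mp (h n) d (by omega)
    rw [map_sub, sub_eq_zero] at this
    rw [this, ih]

theorem X_pow_dvd_sub_of_tendsto {s : ℕ → ℤ⟦X⟧} {l : ℤ⟦X⟧}
    (h : ∀ n, X ^ (n + 1) ∣ s (n + 1) - s n) (hl : Tendsto s atTop (𝓝 l)) (n : ℕ) :
    X ^ (n + 1) ∣ l - s n := by
  refine X_pow_dvd_iff.mpr fun d hd ↦ ?_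
  rw [WithPiTopology.tendsto_iff_coeff_tendsto] at hl
  rw [map_sub, sub_eq_zero, coeff_eq_of_X_pow_dvd_sub h (Nat.le_of_lt_succ hd)]
  refine tendsto_nhds_unique (hl d) (tendsto_const_nhds.congr' ?_)
  filter_upwards [eventually_ge_atTop d] with n hn
  exact (coeff_eq_of_X_pow_dvd_sub h hn).symm

theorem tendsto_mk_coeff {s : ℕ → ℤ⟦X⟧} (h : ∀ n, X ^ (n + 1) ∣ s (n + 1) - s n) :
    Tendsto s atTop (𝓝 (PowerSeries.mk fun d ↦ coeff d (s d))) := by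
  refine (WithPiTopology.tendsto_iff_coeff_tendsto _ _ _ _).mpr fun d ↦
    tendsto_const_nhds.congr' ?_
  filter_upwards [eventually_ge_atTop d] with n hn
  rw [coeff_mk, coeff_eq_of_X_pow_dvd_sub h hn]

theorem tendsto_prod_one_sub_X_pow (k : ℕ) (hk : k ≠ 0) :
    Tendsto (fun n ↦ ∏ i ∈ Finset.range n, (1 - (X : ℤ⟦X⟧) ^ (k * (i + 1)))) atTop
      (𝓝 (expand k hk (pentagonalSeries ℤ))) := by
  have h := ((continuous_expand k hk).tendsto _).comp
    (WithPiTopology.hasProd_one_sub_X_pow ℤ).tendsto_prod_nat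
  simpa [Function.comp_def, map_prod, pow_mul] using h

theorem constantCoeff_pentagonalSeries : constantCoeff (pentagonalSeries ℤ) = 1 := by
  have := coeff_pentagonalSeries_pentagonal ℤ 0
  simpa [pentagonal_def] using this

theorem isUnit_of_constantCoeff_eq_one {f : ℤ⟦X⟧} (h : constantCoeff f = 1) : IsUnit f :=
  isUnit_iff_constantCoeff.mpr (h ▸ isUnit_one)

theorem isUnit_expand_pentagonalSeries (k : ℕ) (hk : k ≠ 0) :
    IsUnit (expand k hk (pentagonalSeries ℤ)) :=
  isUnit_of_constantCoeff_eq_one (by rw [constantCoeff_expand, constantCoeff_pentagonalSeries])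

theorem X_pow_dvd_expand_sub_qFactorial (k : ℕ) (hk : k ≠ 0) (n : ℕ) :
    X ^ (n + 1) ∣ expand k hk (pentagonalSeries ℤ) - qFactorial (X ^ k) n := by
  refine X_pow_dvd_sub_of_tendsto (s := qFactorial (X ^ k)) (fun n ↦ ?_) ?_ n
  · rw [qFactorial_succ, ← pow_mul]
    exact (pow_dvd_pow X (Nat.le_mul_of_pos_left (n + 1) (Nat.pos_of_ne_zero hk))).trans
      ⟨-qFactorial (X ^ k) n, by ring⟩
  · exact (tendsto_prod_one_sub_X_pow k hk).congr fun n ↦ by simp [qFactorial, pow_mul]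

/-- Modulo X^(r+1) every q-factorial of length at least r equals the infinite product P, so the
quotient formula reads [a+b, a] P P = P, and the unit P cancels. -/
theorem X_pow_dvd_expand_mul_gaussBinom_sub_one (k : ℕ) (hk : k ≠ 0) {a b r : ℕ}
    (ha : r ≤ a) (hb : r ≤ b) :
    X ^ (r + 1) ∣ expand k hk (pentagonalSeries ℤ) * gaussBinom (X ^ k) (a + b) a - 1 := by
  have key (m : ℕ) (hm : r ≤ m) : Ideal.Quotient.mk (Ideal.span {(X : ℤ⟦X⟧) ^ (r + 1)})
      (expand k hk (pentagonalSeries ℤ)) = Ideal.Quotient.mk _ (qFactorial (X ^ k) m) :=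
    Ideal.Quotient.eq.mpr <| Ideal.mem_span_singleton.mpr <|
      (pow_dvd_pow X (by omega)).trans (X_pow_dvd_expand_sub_qFactorial k hk m)
  have h := congrArg (Ideal.Quotient.mk (Ideal.span {(X : ℤ⟦X⟧) ^ (r + 1)}))
    (gaussBinom_mul_qFactorial ((X : ℤ⟦X⟧) ^ k) a b)
  rw [map_mul, map_mul, ← key a ha, ← key b hb, ← key (a + b) (by omega)] at h
  have hu := (isUnit_expand_pentagonalSeries k hk).map
    (Ideal.Quotient.mk (Ideal.span {(X : ℤ⟦X⟧) ^ (r + 1)}))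
  rw [← Ideal.mem_span_singleton, ← Ideal.Quotient.eq, map_mul, map_one]
  apply hu.mul_left_cancel
  rw [mul_one]
  conv_rhs => rw [← h]
  ring

/-- Partial sums of the theta series `∑ (-1)^m X^(c (m choose 2) + d (m+1 choose 2))` over `ℤ`. -/
noncomputable def thetaPartial (c d n : ℕ) : ℤ⟦X⟧ :=
  1 + ∑ m ∈ Finset.range n, (-1) ^ (m + 1) *
    (X ^ (c * (m + 1).choose 2 + d * (m + 2).choose 2) +
      X ^ (d * (m + 1).choose 2 + c * (m + 2).choose 2))

theorem thetaPartial_succ (c d n : ℕ) :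
    thetaPartial c d (n + 1) = thetaPartial c d n + (-1) ^ (n + 1) *
    (X ^ (c * (n + 1).choose 2 + d * (n + 2).choose 2) +
      X ^ (d * (n + 1).choose 2 + c * (n + 2).choose 2)) := by
  rw [thetaPartial, thetaPartial, Finset.sum_range_succ, add_assoc]

/-- Guarantees that coefficient n is already final in the n-th partial sum of the theta series. -/
theorem succ_le_theta_exponent {c d : ℕ} (hd : 0 < d) (m : ℕ) :
    m + 1 ≤ c * (m + 1).choose 2 + d * (m + 2).choose 2 := by
  have h2 : (m + 2).choose 2 = (m + 1).choose 2 + (m + 1) := by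
    simpa using choose_two_add (m + 1) 1
  nlinarith [Nat.zero_le (c * (m + 1).choose 2), Nat.zero_le ((m + 1).choose 2)]

/-- The two-sided theta series `∑ (-1)^m X^(c (m choose 2) + d (m+1 choose 2))`. -/
noncomputable def theta (c d : ℕ) : ℤ⟦X⟧ :=
  PowerSeries.mk fun n ↦ coeff n (thetaPartial c d n)

theorem tendsto_thetaPartial {c d : ℕ} (hc : 0 < c) (hd : 0 < d) :
    Tendsto (thetaPartial c d) atTop (𝓝 (theta c d)) := by
  refine tendsto_mk_coeff fun n ↦ ?_
  rw [thetaPartial_succ, add_sub_cancel_left]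
  exact Dvd.dvd.mul_left (dvd_add (pow_dvd_pow X (succ_le_theta_exponent hd n))
    (pow_dvd_pow X (succ_le_theta_exponent hc n))) _

theorem constantCoeff_theta (c d : ℕ) : constantCoeff (theta c d) = 1 := by
  rw [← coeff_zero_eq_constantCoeff_apply, theta, coeff_mk]
  simp [thetaPartial]

/-- The Jacobi triple product identity, as a limit of power series. -/
theorem tendsto_jacobi_product {c d k : ℕ} (hc : 0 < c) (hd : 0 < d) (hk : k ≠ 0)
    (hcd : c + d = k) :
    Tendsto (fun n ↦ expand k hk (pentagonalSeries ℤ) *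
        ∏ i ∈ Finset.range n, ((1 - (X : ℤ⟦X⟧) ^ (k * i + c)) * (1 - X ^ (k * i + d)))) atTop
      (𝓝 (theta c d)) := by
  refine tendsto_of_X_pow_dvd_sub (fun n ↦ ?_) (tendsto_thetaPartial hc hd)
  have h := prod_one_sub_mul_one_sub_eq_sum_gaussBinom (R := ℤ⟦X⟧)
    (pow_ne_zero c X_ne_zero) (pow_ne_zero d X_ne_zero) n
  have h' : ∏ i ∈ Finset.range n, ((1 - (X : ℤ⟦X⟧) ^ (k * i + c)) * (1 - X ^ (k * i + d))) =
      ∏ i ∈ Finset.range n, ((1 - (X : ℤ⟦X⟧) ^ c * (X ^ c * X ^ d) ^ i) *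
        (1 - X ^ d * (X ^ c * X ^ d) ^ i)) :=
    Finset.prod_congr rfl fun i _ ↦ by rw [← pow_add, hcd]; ring
  rw [h', h, ← pow_add, hcd, thetaPartial, mul_add, Finset.mul_sum, add_sub_add_comm,
    ← Finset.sum_sub_distrib]
  refine dvd_add ?_ (Finset.dvd_sum fun m hm ↦ ?_)
  · rw [two_mul, dvd_sub_comm]
    exact X_pow_dvd_expand_mul_gaussBinom_sub_one k hk le_rfl le_rfl
  have hm := Finset.mem_range.mp hm
  obtain ⟨j, rfl⟩ : ∃ j, n = m + 1 + j := ⟨n - (m + 1), by omega⟩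
  have g1 := X_pow_dvd_expand_mul_gaussBinom_sub_one k hk (a := m + 1 + j + (m + 1)) (b := j)
    (r := j) (by omega) le_rfl
  have g2 := X_pow_dvd_expand_mul_gaussBinom_sub_one k hk (a := j) (b := m + 1 + j + (m + 1))
    (r := j) le_rfl (by omega)
  rw [show m + 1 + j + (m + 1) + j = 2 * (m + 1 + j) by ring] at g1
  rw [show j + (m + 1 + j + (m + 1)) = 2 * (m + 1 + j) by ring] at g2
  rw [show m + 1 + j - (m + 1) = j by omega]
  -- The binomial is only accurate to order j + 1, but the monomial it multiplies supplies the
  -- missing m + 1 powers of X.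
  have d1 := mul_dvd_mul g1 (pow_dvd_pow (X : ℤ⟦X⟧) (succ_le_theta_exponent (c := c) hd m))
  have d2 := mul_dvd_mul g2 (pow_dvd_pow (X : ℤ⟦X⟧) (succ_le_theta_exponent (c := d) hc m))
  rw [← pow_add, show j + 1 + (m + 1) = m + 1 + j + 1 by ring] at d1 d2
  refine (Dvd.dvd.mul_left (dvd_add d1 d2) (-(-1) ^ (m + 1))).trans (dvd_of_eq ?_)
  ring

/-- The triple product gives f_2 ∏ (1 - q^(2i+1))², and f_1 is the odd product times f_2. -/
theorem theta_one_one_mul_expand :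
    theta 1 1 * expand 2 two_ne_zero (pentagonalSeries ℤ) = pentagonalSeries ℤ ^ 2 := by
  have hu := isUnit_expand_pentagonalSeries 2 two_ne_zero
  have h1 := tendsto_jacobi_product one_pos one_pos two_ne_zero rfl
  have h2 := tendsto_prod_one_sub_X_pow 2 two_ne_zero
  have h3 := (tendsto_prod_one_sub_X_pow 1 one_ne_zero).comp
    (tendsto_id.const_mul_atTop' (r := 2) two_pos)
  have h4 := (h1.mul (h2.mul h2))
  have h5 := (h3.mul h3).const_mul (expand 2 two_ne_zero (pentagonalSeries ℤ))
  have h6 : ∀ n, ∏ i ∈ Finset.range (2 * n), (1 - (X : ℤ⟦X⟧) ^ (1 * (i + 1))) =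
      (∏ i ∈ Finset.range n, (1 - (X : ℤ⟦X⟧) ^ (2 * i + 1))) *
        ∏ i ∈ Finset.range n, (1 - (X : ℤ⟦X⟧) ^ (2 * (i + 1))) := by
    intro n
    induction n with
    | zero => simp
    | succ n ih =>
      rw [mul_add_one, Finset.prod_range_succ, Finset.prod_range_succ, ih,
        Finset.prod_range_succ, Finset.prod_range_succ]
      ring
  have h7 := tendsto_nhds_unique h4 (h5.congr fun n ↦ by
    simp only [Function.comp_apply, id_eq, h6, Finset.prod_mul_distrib]
    ring)
  rw [expand_one_apply] at h7
  apply hu.mul_right_cancel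
  linear_combination h7

/-- The triple product gives f_6 times the product over exponents ±1 mod 6. By inclusion-exclusion
that product is f_1 f_6/(f_2 f_3). -/
theorem theta_one_five_mul_expand :
    theta 1 5 * expand 3 three_ne_zero (pentagonalSeries ℤ) *
      expand 2 two_ne_zero (pentagonalSeries ℤ) =
    expand 6 (by norm_num) (pentagonalSeries ℤ) ^ 2 * pentagonalSeries ℤ := by
  have h1 := tendsto_jacobi_product (k := 6) one_pos (show 0 < 5 by norm_num) (by norm_num) rfl
  have h2 := (tendsto_prod_one_sub_X_pow 2 two_ne_zero).comp
    (tendsto_id.const_mul_atTop' (r := 3) three_pos)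
  have h3 := (tendsto_prod_one_sub_X_pow 3 three_ne_zero).comp
    (tendsto_id.const_mul_atTop' (r := 2) two_pos)
  have h4 := (tendsto_prod_one_sub_X_pow 1 one_ne_zero).comp
    (tendsto_id.const_mul_atTop' (r := 6) (by norm_num))
  have h5 := tendsto_prod_one_sub_X_pow 6 (by norm_num)
  have h6 : ∀ n, (∏ i ∈ Finset.range (6 * n), (1 - (X : ℤ⟦X⟧) ^ (1 * (i + 1)))) *
      (∏ i ∈ Finset.range n, (1 - (X : ℤ⟦X⟧) ^ (6 * (i + 1)))) =
      (∏ i ∈ Finset.range n, ((1 - (X : ℤ⟦X⟧) ^ (6 * i + 1)) * (1 - X ^ (6 * i + 5)))) *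
      (∏ i ∈ Finset.range (2 * n), (1 - (X : ℤ⟦X⟧) ^ (3 * (i + 1)))) *
      ∏ i ∈ Finset.range (3 * n), (1 - (X : ℤ⟦X⟧) ^ (2 * (i + 1))) := by
    intro n
    induction n with
    | zero => simp
    | succ n ih =>
      simp only [mul_add_one 6 n, mul_add_one 2 n, mul_add_one 3 n, Finset.prod_range_succ]
      rw [show ∀ a b c d e f g h i : ℤ⟦X⟧, a * b * c * d * e * f * g * (h * i) =
        (a * h) * (b * c * d * e * f * g * i) by intros; ring, ih]
      ring
  have h7 := tendsto_nhds_unique ((h1.mul h3).mul h2)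
    (((h4.mul h5).const_mul (expand 6 (by norm_num) (pentagonalSeries ℤ))).congr fun n ↦ by
      simp only [Function.comp_apply, id_eq, h6]
      ring)
  rw [expand_one_apply] at h7
  linear_combination h7

theorem two_mul_choose_two_succ (m : ℕ) : 2 * (m + 1).choose 2 = m * (m + 1) := by
  induction m with
  | zero => rfl
  | succ m ih =>
    have := choose_two_add (m + 1) 1
    simp at this
    rw [this]
    linarith

theorem choose_two_succ_add (m : ℕ) :
    1 * (m + 1).choose 2 + 1 * (m + 2).choose 2 = (m + 1) ^ 2 := by
  have h1 := two_mul_choose_two_succ m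
  have h2 := two_mul_choose_two_succ (m + 1)
  rw [add_assoc] at h2
  linarith

/-- The 3-dissection of `φ(-q)`. -/
theorem theta_one_one_dissection :
    theta 1 1 = expand 3 three_ne_zero (expand 3 three_ne_zero (theta 1 1)) -
      2 * X * expand 3 three_ne_zero (theta 1 5) := by
  -- The left side runs over |m| ≤ 3n + 1. Multiples of 3 give the first term; the other squares are
  -- (3k+1)² with |k| ≤ n, each hit twice with sign -(-1)^k.
  have hfin : ∀ n, thetaPartial 1 1 (3 * n + 1) =
      expand 3 three_ne_zero (expand 3 three_ne_zero (thetaPartial 1 1 n)) -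
        2 * X * expand 3 three_ne_zero (thetaPartial 1 5 n) := by
    intro n
    induction n with
    | zero => simp [thetaPartial]; ring
    | succ n ih =>
      rw [show 3 * (n + 1) + 1 = 3 * n + 1 + 1 + 1 + 1 by ring]
      rw [thetaPartial_succ 1 1 (3 * n + 1 + 1 + 1), thetaPartial_succ 1 1 (3 * n + 1 + 1),
        thetaPartial_succ 1 1 (3 * n + 1), ih]
      simp only [thetaPartial_succ, map_add, map_mul, map_pow, map_neg, map_one, expand_X,
        choose_two_succ_add]
      -- The exponents of `theta 1 5` are 3m² + 2m, and 3(3m² + 2m) + 1 = (3m+1)²; here m = ±(n+1).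
      have e1 : 3 * (1 * (n + 1).choose 2 + 5 * (n + 2).choose 2) + 1 = (3 * n + 4) ^ 2 := by
        have h1 := two_mul_choose_two_succ n
        have h2 := two_mul_choose_two_succ (n + 1)
        rw [add_assoc] at h2
        linarith
      have e2 : 3 * (5 * (n + 1).choose 2 + 1 * (n + 2).choose 2) + 1 = (3 * n + 2) ^ 2 := by
        have h1 := two_mul_choose_two_succ n
        have h2 := two_mul_choose_two_succ (n + 1)
        rw [add_assoc] at h2
        linarith
      have e3 (a b : ℤ⟦X⟧) (i j : ℕ) : 2 * X * (a + b * ((X ^ 3) ^ i + (X ^ 3) ^ j)) =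
          2 * X * a + 2 * b * (X ^ (3 * i + 1) + X ^ (3 * j + 1)) := by ring
      rw [e3, e1, e2]
      have e4 : ((-1 : ℤ⟦X⟧)) ^ (3 * n) = (-1) ^ n := by rw [pow_mul]; norm_num
      simp only [pow_succ (-1 : ℤ⟦X⟧), e4]
      ring
  have h1 := tendsto_thetaPartial one_pos one_pos
  have h2 := tendsto_thetaPartial one_pos (show 0 < 5 by norm_num)
  have hc := continuous_expand 3 three_ne_zero
  have h3 : Tendsto (fun n : ℕ ↦ 3 * n + 1) atTop atTop :=
    tendsto_atTop_mono (fun n ↦ by simp only [id]; omega) tendsto_id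
  refine tendsto_nhds_unique (h1.comp h3) ?_
  refine Tendsto.congr (fun n ↦ (hfin n).symm) ?_
  exact ((hc.tendsto _).comp ((hc.tendsto _).comp h1)).sub
    (((hc.tendsto _).comp h2).const_mul _)

end Limits

/-! ### The generating function f_ℓ/φ(-q) -/

section GeneratingFunction

open Filter Topology Nat.Partition
open scoped PowerSeries.WithPiTopology

/-- The number of ways to overline a part of size `i` occurring `c ≥ 1` times. -/
def overlineWeight (ℓ i c : ℕ) : ℤ :=
  (if ¬ ℓ ∣ i ∨ c = 1 then 1 else 0) + if ¬ ℓ ∣ i then 1 else 0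

/-- Overlining removes one copy, so a multiple of ℓ is admissible only if overlined and occurring
once. -/
theorem isRegularParts_sub_iff {ℓ : ℕ} {m : Multiset ℕ} {s : Finset ℕ} (hs : s ⊆ m.toFinset) :
    IsRegularParts ℓ (m - s.val) ↔
      (∀ i ∈ s, ¬ ℓ ∣ i ∨ m.count i = 1) ∧ ∀ i ∈ m.toFinset \ s, ¬ ℓ ∣ i := by
  have hcount (i : ℕ) : (m - s.val).count i = m.count i - if i ∈ s then 1 else 0 := by
    rw [Multiset.count_sub, Multiset.count_eq_of_nodup s.nodup]
    rfl
  have hmem (i : ℕ) : i ∈ m - s.val ↔ 0 < m.count i - if i ∈ s then 1 else 0 := by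
    rw [← hcount, Multiset.count_pos]
  constructor
  · refine fun h ↦ ⟨fun i hi ↦ ?_, fun i hi ↦ ?_⟩
    · have h1 := Multiset.count_pos.mpr (Multiset.mem_toFinset.mp (hs hi))
      refine or_iff_not_imp_right.mpr fun hc ↦ h i ((hmem i).mpr ?_)
      rw [if_pos hi]
      omega
    · rw [Finset.mem_sdiff, Multiset.mem_toFinset] at hi
      refine h i ((hmem i).mpr ?_)
      rw [if_neg hi.2]
      exact Multiset.count_pos.mpr hi.1
  · rintro ⟨h1, h2⟩ i hi
    by_cases his : i ∈ s
    · refine (h1 i his).resolve_right fun hc ↦ ?_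
      rw [hmem, if_pos his, hc] at hi
      exact lt_irrefl _ hi
    · rw [hmem, if_neg his] at hi
      exact h2 i (Finset.mem_sdiff.mpr ⟨Multiset.mem_toFinset.mpr (Multiset.count_pos.mp hi), his⟩)

/-- Regular overpartitions as pairs of a partition and an admissible set of overlined sizes. -/
def regularOverpartitionEquiv (ℓ n : ℕ) :
    {π : Overpartition n // IsRegularParts ℓ π.nonOverlined} ≃
      Σ p : n.Partition, {s : Finset ℕ //
        s ∈ p.parts.toFinset.powerset.filter fun s ↦ IsRegularParts ℓ (p.parts - s.val)} where
  toFun π := ⟨π.1.partition, π.1.overlined,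
    Finset.mem_filter.mpr ⟨Finset.mem_powerset.mpr π.1.overlined_subset, π.2⟩⟩
  invFun x := ⟨⟨x.1, x.2.1, Finset.mem_powerset.mp (Finset.mem_filter.mp x.2.2).1⟩,
    (Finset.mem_filter.mp x.2.2).2⟩
  left_inv _ := rfl
  right_inv _ := rfl

/-- Expanding the product of two-term weights over the part sizes yields a sum over subsets, namely
the sets of overlined sizes. -/
theorem coeff_genFun_overlineWeight (ℓ n : ℕ) :
    coeff n (genFun (overlineWeight ℓ)) = (RbarStar ℓ n : ℤ) := by
  rw [RbarStar, Fintype.card_congr (regularOverpartitionEquiv ℓ n), Fintype.card_sigma,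
    coeff_genFun, Nat.cast_sum]
  refine Finset.sum_congr rfl fun p _ ↦ ?_
  rw [Fintype.card_coe, Finset.card_filter, Nat.cast_sum, Finsupp.prod]
  simp only [overlineWeight, Finset.prod_add, Multiset.toFinsupp_support,
    Finset.prod_boole]
  refine Finset.sum_congr rfl fun s hs ↦ ?_
  rw [ite_zero_mul_ite_zero, mul_one, Nat.cast_ite]
  rw [Nat.cast_one, Nat.cast_zero]
  exact if_congr (isRegularParts_sub_iff (Finset.mem_powerset.mp hs)).symm rfl rfl

theorem hasProd_one_sub_X_pow_expand (k : ℕ) (hk : k ≠ 0) :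
    HasProd (fun i ↦ (1 - (X : ℤ⟦X⟧) ^ (k * (i + 1)))) (expand k hk (pentagonalSeries ℤ)) := by
  have h := (WithPiTopology.hasProd_one_sub_X_pow ℤ).map (expand k hk) (continuous_expand k hk)
  simpa [Function.comp_def, pow_mul] using h

/-- Padding with 1s indexes the product by all sizes, so that products can be compared factor by
factor. -/
theorem hasProd_one_sub_X_pow_of_dvd (k : ℕ) (hk : k ≠ 0) :
    HasProd (fun i ↦ if k ∣ i + 1 then (1 - (X : ℤ⟦X⟧) ^ (i + 1)) else 1)
      (expand k hk (pentagonalSeries ℤ)) := by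
  have hpos := Nat.pos_of_ne_zero hk
  have hk1 (i : ℕ) : k * (i + 1) - 1 + 1 = k * (i + 1) :=
    Nat.sub_add_cancel (Nat.mul_pos hpos i.succ_pos)
  have hinj : Function.Injective fun i ↦ k * (i + 1) - 1 := by
    intro a b h
    have h' : k * (a + 1) = k * (b + 1) := by rw [← hk1 a, ← hk1 b]; exact congrArg (· + 1) h
    exact Nat.succ_injective (Nat.eq_of_mul_eq_mul_left hpos h')
  rw [← hinj.hasProd_iff]
  · simpa [Function.comp_def, hk1] using hasProd_one_sub_X_pow_expand k hk
  · intro i hi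
    refine if_neg fun ⟨j, hj⟩ ↦ hi ⟨j - 1, ?_⟩
    have : j ≠ 0 := by rintro rfl; simp at hj
    simp only [Nat.sub_add_cancel (Nat.one_le_iff_ne_zero.mpr this), ← hj]
    simp

/-- With x = X^(i+1), the local factor is 1 + x if ℓ divides i + 1, and (1 + x)/(1 - x) otherwise.
-/
theorem genFun_overlineWeight_factor (ℓ i : ℕ) :
    (1 + ∑' j, overlineWeight ℓ (i + 1) (j + 1) • (X : ℤ⟦X⟧) ^ ((i + 1) * (j + 1))) *
      ((1 - X ^ (1 * (i + 1))) * (1 - X ^ (1 * (i + 1)))) =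
    (1 - X ^ (2 * (i + 1))) * if ℓ ∣ i + 1 then 1 - X ^ (i + 1) else 1 := by
  by_cases h : ℓ ∣ i + 1
  · rw [tsum_eq_single 0 fun j hj ↦ by simp [overlineWeight, h, hj]]
    simp [overlineWeight, h]
    ring
  · have hx : constantCoeff ((X : ℤ⟦X⟧) ^ (i + 1)) = 0 := by simp
    have hs := WithPiTopology.summable_pow_of_constantCoeff_eq_zero hx
    have hg := WithPiTopology.tsum_pow_mul_one_sub_of_constantCoeff_eq_zero hx
    have ht : ∑' j, overlineWeight ℓ (i + 1) (j + 1) • (X : ℤ⟦X⟧) ^ ((i + 1) * (j + 1)) =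
        2 * X ^ (i + 1) * ∑' j, (X ^ (i + 1)) ^ j := by
      rw [← hs.tsum_mul_left]
      refine tsum_congr fun j ↦ ?_
      simp [overlineWeight, h]
      ring
    rw [ht, if_neg h]
    linear_combination 2 * X ^ (i + 1) * (1 - X ^ (i + 1)) * hg

theorem genFun_overlineWeight_mul_theta (ℓ : ℕ) (hℓ : ℓ ≠ 0) :
    genFun (overlineWeight ℓ) * theta 1 1 = expand ℓ hℓ (pentagonalSeries ℤ) := by
  have h1 := hasProd_one_sub_X_pow_expand 1 one_ne_zero
  have h := ((hasProd_genFun (overlineWeight ℓ)).mul (h1.mul h1)).unique <|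
    ((hasProd_one_sub_X_pow_expand 2 two_ne_zero).mul
      (hasProd_one_sub_X_pow_of_dvd ℓ hℓ)).congr_fun fun i ↦ genFun_overlineWeight_factor ℓ i
  rw [expand_one_apply] at h
  apply (isUnit_expand_pentagonalSeries 2 two_ne_zero).mul_right_cancel
  linear_combination h + genFun (overlineWeight ℓ) * theta_one_one_mul_expand

end GeneratingFunction

/-! ### Extracting residue classes mod 3 -/

section Sections

/-- The series `∑ aₙ Xⁿ` restricted to the progression `3n + r`. -/
noncomputable def progression (r : ℕ) : ℤ⟦X⟧ →+ ℤ⟦X⟧ where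
  toFun F := PowerSeries.mk fun n ↦ coeff (3 * n + r) F
  map_zero' := by ext; simp
  map_add' F G := by ext; simp

@[simp]
theorem coeff_progression (r n : ℕ) (F : ℤ⟦X⟧) :
    coeff n (progression r F) = coeff (3 * n + r) F := by
  simp [progression]

theorem coeff_X_pow_mul_expand_three {r s : ℕ} (hr : r < 3) (hs : s < 3) (m : ℕ) (H : ℤ⟦X⟧) :
    coeff (3 * m + s) (X ^ r * expand 3 three_ne_zero H) = if r = s then coeff m H else 0 := by
  rw [coeff_X_pow_mul']
  split_ifs with h1 h2 h2
  · rw [h2, Nat.add_sub_cancel, coeff_expand_mul]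
  · exact coeff_expand_of_not_dvd _ _ _ (by omega)
  · omega
  · rfl

theorem progression_X_pow_mul_expand {r s : ℕ} (hr : r < 3) (hs : s < 3) (H : ℤ⟦X⟧) :
    progression s (X ^ r * expand 3 three_ne_zero H) = if r = s then H else 0 := by
  ext m
  rw [coeff_progression, coeff_X_pow_mul_expand_three hr hs]
  split_ifs <;> simp

theorem eq_sum_progression (F : ℤ⟦X⟧) :
    F = ∑ r ∈ Finset.range 3, X ^ r * expand 3 three_ne_zero (progression r F) := by
  ext n
  have hs : n % 3 < 3 := Nat.mod_lt _ three_pos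
  rw [← Nat.div_add_mod n 3, map_sum, Finset.sum_congr rfl fun r hr ↦
    coeff_X_pow_mul_expand_three (Finset.mem_range.mp hr) hs _ _, Finset.sum_ite_eq',
    if_pos (Finset.mem_range.mpr hs), coeff_progression]

/-- Extraction is linear over series in q³. -/
theorem progression_mul_expand {s : ℕ} (hs : s < 3) (F H : ℤ⟦X⟧) :
    progression s (F * expand 3 three_ne_zero H) = progression s F * H := by
  conv_lhs => rw [eq_sum_progression F, Finset.sum_mul, map_sum]
  rw [Finset.sum_congr rfl fun r hr ↦ by
    rw [mul_assoc, ← map_mul, progression_X_pow_mul_expand (Finset.mem_range.mp hr) hs],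
    Finset.sum_ite_eq', if_pos (Finset.mem_range.mpr hs)]

theorem progression_natCast_mul {s : ℕ} (hs : s < 3) (c : ℕ) (F : ℤ⟦X⟧) :
    progression s (c * F) = c * progression s F := by
  have := progression_mul_expand hs F (c : ℤ⟦X⟧)
  rwa [map_natCast, mul_comm, mul_comm _ (c : ℤ⟦X⟧)] at this

theorem natCast_dvd_progression {s : ℕ} (hs : s < 3) {c : ℕ} {F : ℤ⟦X⟧} (h : (c : ℤ⟦X⟧) ∣ F) :
    (c : ℤ⟦X⟧) ∣ progression s F := by
  obtain ⟨G, rfl⟩ := h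
  exact ⟨_, progression_natCast_mul hs c G⟩

theorem natCast_dvd_of_dvd_expand {c : ℕ} {F : ℤ⟦X⟧}
    (h : (c : ℤ⟦X⟧) ∣ expand 3 three_ne_zero F) : (c : ℤ⟦X⟧) ∣ F := by
  have := natCast_dvd_progression three_pos h
  rwa [← one_mul (expand 3 three_ne_zero F), ← pow_zero X,
    progression_X_pow_mul_expand three_pos three_pos, if_pos rfl] at this

theorem dvd_coeff_of_natCast_dvd {c : ℕ} {F : ℤ⟦X⟧} (h : (c : ℤ⟦X⟧) ∣ F) (n : ℕ) :
    (c : ℤ) ∣ coeff n F := by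
  obtain ⟨G, rfl⟩ := h
  exact ⟨coeff n G, by rw [← map_natCast (C (R := ℤ)), coeff_C_mul]⟩

theorem natCast_dvd_of_map_eq_zero {c : ℕ} {F : ℤ⟦X⟧}
    (h : PowerSeries.map (Int.castRingHom (ZMod c)) F = 0) : (c : ℤ⟦X⟧) ∣ F := by
  have h' (n : ℕ) : (c : ℤ) ∣ coeff n F := by
    have := congrArg (coeff n) h
    rwa [coeff_map, map_zero, eq_intCast, ZMod.intCast_zmod_eq_zero_iff_dvd] at this
  choose g hg using h'
  refine ⟨PowerSeries.mk g, ?_⟩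
  ext n
  rw [← map_natCast (C (R := ℤ)), coeff_C_mul, coeff_mk, hg]

/-- Frobenius over the field with three elements. -/
theorem three_dvd_expand_sub_cube (F : ℤ⟦X⟧) :
    ((3 : ℕ) : ℤ⟦X⟧) ∣ expand 3 three_ne_zero F - F ^ 3 := by
  have : Fact (Nat.Prime 3) := ⟨Nat.prime_three⟩
  apply natCast_dvd_of_map_eq_zero
  have h := MvPowerSeries.map_frobenius_expand 3 three_ne_zero
    (f := PowerSeries.map (Int.castRingHom (ZMod 3)) F)
  rw [ZMod.frobenius_zmod, MvPowerSeries.map_id] at h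
  rw [map_sub, map_pow, map_expand, sub_eq_zero]
  exact h

end Sections

/-! ### The congruences -/

section Congruences

/-- `φ(-q) φ(-ωq) φ(-ω²q)` as a series in `q³`, where `ω` is a primitive cube root of unity. -/
noncomputable def thetaNorm : ℤ⟦X⟧ :=
  expand 3 three_ne_zero (theta 1 1) ^ 3 - 8 * X * theta 1 5 ^ 3

theorem isUnit_thetaNorm : IsUnit thetaNorm :=
  isUnit_of_constantCoeff_eq_one (by simp [thetaNorm, constantCoeff_theta])

theorem isUnit_theta (c d : ℕ) : IsUnit (theta c d) :=
  isUnit_of_constantCoeff_eq_one (constantCoeff_theta c d)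

/-- Modulo 3, N(q³) = a³ - 8q³b³ ≡ (a - 2qb)³ = φ(-q)³ ≡ φ(-q³); then q³ is replaced by q. -/
theorem three_dvd_thetaNorm_sub_theta : ((3 : ℕ) : ℤ⟦X⟧) ∣ thetaNorm - theta 1 1 := by
  apply natCast_dvd_of_dvd_expand
  obtain ⟨G, hG⟩ := three_dvd_expand_sub_cube (theta 1 1)
  have h := theta_one_one_dissection
  simp only [thetaNorm, map_sub, map_mul, map_pow, map_ofNat, expand_X]
  set a := expand 3 three_ne_zero (expand 3 three_ne_zero (theta 1 1))
  set b := expand 3 three_ne_zero (theta 1 5)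
  refine ⟨2 * a ^ 2 * X * b - 4 * a * X ^ 2 * b ^ 2 - G, ?_⟩
  rw [h] at hG
  rw [h]
  push_cast at hG ⊢
  linear_combination -hG

theorem progression_theta_one_one :
    progression 1 (theta 1 1) = -2 * theta 1 5 ∧ progression 2 (theta 1 1) = 0 := by
  have h : theta 1 1 = X ^ 0 * expand 3 three_ne_zero (expand 3 three_ne_zero (theta 1 1)) +
      X ^ 1 * expand 3 three_ne_zero (-2 * theta 1 5) := by
    conv_lhs => rw [theta_one_one_dissection]
    simp only [map_mul, map_neg, map_ofNat]
    ring
  constructor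
  all_goals
    rw [h, map_add, progression_X_pow_mul_expand (by norm_num) (by norm_num),
      progression_X_pow_mul_expand (by norm_num) (by norm_num)]
    simp

/-- Here F = φ(-q) K(q³)/(N(q) H(q³)), the common shape after the first extraction. The moduli 3 and
8 are treated separately and combined by coprimality. -/
theorem dvd_progression_of_mul_thetaNorm {F H K : ℤ⟦X⟧} (hH : IsUnit H)
    (h : F * thetaNorm * expand 3 three_ne_zero H = expand 3 three_ne_zero K * theta 1 1) :
    ((6 : ℕ) : ℤ⟦X⟧) ∣ progression 1 F ∧ ((24 : ℕ) : ℤ⟦X⟧) ∣ progression 2 F := by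
  have h3 : ((3 : ℕ) : ℤ⟦X⟧) ∣ F * expand 3 three_ne_zero H - expand 3 three_ne_zero K := by
    refine (isUnit_theta 1 1).dvd_mul_left.mp ?_
    obtain ⟨W, hW⟩ := three_dvd_thetaNorm_sub_theta
    exact ⟨-F * expand 3 three_ne_zero H * W, by
      linear_combination h - F * expand 3 three_ne_zero H * hW⟩
  have h3' (s : ℕ) (hs : s < 3) (hs0 : 0 ≠ s) : ((3 : ℕ) : ℤ⟦X⟧) ∣ progression s F := by
    have := natCast_dvd_progression hs h3
    rw [map_sub, progression_mul_expand hs, ← one_mul (expand 3 three_ne_zero K), ← pow_zero X,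
      progression_X_pow_mul_expand three_pos hs, if_neg hs0, sub_zero] at this
    exact hH.dvd_mul_right.mp this
  have h8 : ((8 : ℕ) : ℤ⟦X⟧) ∣ F * expand 3 three_ne_zero (theta 1 1 ^ 3 * H) -
      theta 1 1 * expand 3 three_ne_zero K := by
    refine ⟨F * expand 3 three_ne_zero H * X * theta 1 5 ^ 3, ?_⟩
    rw [thetaNorm] at h
    rw [map_mul, map_pow]
    push_cast
    linear_combination h
  have hu : IsUnit (theta 1 1 ^ 3 * H) := ((isUnit_theta 1 1).pow 3).mul hH
  have h8' (s : ℕ) (hs : s < 3) : ((8 : ℕ) : ℤ⟦X⟧) ∣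
      progression s F * (theta 1 1 ^ 3 * H) - progression s (theta 1 1) * K := by
    have := natCast_dvd_progression hs h8
    rwa [map_sub, progression_mul_expand hs, progression_mul_expand hs] at this
  have h2 : ((2 : ℕ) : ℤ⟦X⟧) ∣ progression 1 F := by
    obtain ⟨W, hW⟩ := h8' 1 (by norm_num)
    rw [progression_theta_one_one.1] at hW
    -- Class 1 of φ(-q) is -2Ω, so only a factor 2 of the modulus 8 survives.
    refine hu.dvd_mul_right.mp ⟨4 * W - theta 1 5 * K, ?_⟩
    push_cast at hW ⊢
    linear_combination hW
  have h8'' : ((8 : ℕ) : ℤ⟦X⟧) ∣ progression 2 F := by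
    have := h8' 2 (by norm_num)
    rw [progression_theta_one_one.2, zero_mul, sub_zero] at this
    exact hu.dvd_mul_right.mp this
  have hcop (a b : ℕ) (hab : a.Coprime b) : IsCoprime (a : ℤ⟦X⟧) (b : ℤ⟦X⟧) :=
    Nat.Coprime.cast hab
  constructor
  · rw [show 6 = 2 * 3 by rfl, Nat.cast_mul]
    exact (hcop 2 3 (by norm_num)).mul_dvd h2 (h3' 1 (by norm_num) (by norm_num))
  · rw [show 24 = 8 * 3 by rfl, Nat.cast_mul]
    exact (hcop 8 3 (by norm_num)).mul_dvd h8'' (h3' 2 (by norm_num) (by norm_num))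

theorem mul_dvd_progression_of_mul_thetaNorm {F H K : ℤ⟦X⟧} {c : ℕ} (hc : c ≠ 0) (hH : IsUnit H)
    (h : F * thetaNorm * expand 3 three_ne_zero H = c * (expand 3 three_ne_zero K * theta 1 1)) :
    ((c * 6 : ℕ) : ℤ⟦X⟧) ∣ progression 1 F ∧ ((c * 24 : ℕ) : ℤ⟦X⟧) ∣ progression 2 F := by
  have hH' : IsUnit (thetaNorm * expand 3 three_ne_zero H) := isUnit_thetaNorm.mul (hH.map _)
  obtain ⟨F', rfl⟩ : (c : ℤ⟦X⟧) ∣ F := hH'.dvd_mul_right.mp ⟨_, (mul_assoc _ _ _).symm.trans h⟩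
  have hc' : (c : ℤ⟦X⟧) ≠ 0 := fun h0 ↦ hc (by simpa using congrArg constantCoeff h0)
  have := dvd_progression_of_mul_thetaNorm (F := F') (K := K) hH
    (mul_left_cancel₀ hc' (by linear_combination h))
  rw [progression_natCast_mul (by norm_num), progression_natCast_mul (by norm_num), Nat.cast_mul,
    Nat.cast_mul]
  exact ⟨mul_dvd_mul_left _ this.1, mul_dvd_mul_left _ this.2⟩

/-- Multiply h by a² + 2qab + 4q²b²: this turns φ(-q) into N(q³), and the three terms lie in
distinct classes mod 3. -/
theorem progression_mul_thetaNorm {G F : ℤ⟦X⟧}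
    (h : G * theta 1 1 = expand 3 three_ne_zero F) :
    progression 1 G * thetaNorm = 2 * F * expand 3 three_ne_zero (theta 1 1) * theta 1 5 ∧
      progression 2 G * thetaNorm = 4 * F * theta 1 5 ^ 2 := by
  have hG : G * expand 3 three_ne_zero thetaNorm =
      X ^ 0 * expand 3 three_ne_zero (F * expand 3 three_ne_zero (theta 1 1) ^ 2) +
      X ^ 1 * expand 3 three_ne_zero (2 * F * expand 3 three_ne_zero (theta 1 1) * theta 1 5) +
      X ^ 2 * expand 3 three_ne_zero (4 * F * theta 1 5 ^ 2) := by
    rw [theta_one_one_dissection] at h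
    simp only [thetaNorm, map_sub, map_mul, map_pow, map_ofNat, expand_X]
    rw [← h]
    ring
  constructor
  all_goals
    rw [← progression_mul_expand (by norm_num), hG, map_add, map_add,
      progression_X_pow_mul_expand (by norm_num) (by norm_num),
      progression_X_pow_mul_expand (by norm_num) (by norm_num),
      progression_X_pow_mul_expand (by norm_num) (by norm_num)]
    simp

theorem expand_six_eq : expand 6 (by norm_num) (pentagonalSeries ℤ) =
    expand 3 three_ne_zero (expand 2 two_ne_zero (pentagonalSeries ℤ)) :=
  expand_mul 3 three_ne_zero 2 two_ne_zero _

open Nat.Partition in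
theorem dvd_progression_genFun_three :
    ((12 : ℕ) : ℤ⟦X⟧) ∣ progression 1 (progression 1 (genFun (overlineWeight 3))) ∧
      ((48 : ℕ) : ℤ⟦X⟧) ∣ progression 2 (progression 1 (genFun (overlineWeight 3))) := by
  -- Class 1 is 2 f_1 φ(-q³) Ω/N = 2 φ(-q) φ(-q³) f_6²/(f_3 N), which dictates H and K.
  refine mul_dvd_progression_of_mul_thetaNorm (c := 2) two_ne_zero (H := pentagonalSeries ℤ)
    (K := expand 2 two_ne_zero (pentagonalSeries ℤ) ^ 2 * theta 1 1)
    (isUnit_of_constantCoeff_eq_one constantCoeff_pentagonalSeries) ?_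
  rw [(progression_mul_thetaNorm (genFun_overlineWeight_mul_theta 3 three_ne_zero)).1]
  apply (isUnit_expand_pentagonalSeries 2 two_ne_zero).mul_right_cancel
  have h1 := theta_one_one_mul_expand
  have h2 := theta_one_five_mul_expand
  rw [expand_six_eq] at h2
  rw [map_mul, map_pow]
  set a := expand 3 three_ne_zero (theta 1 1)
  set f := expand 3 three_ne_zero (expand 2 two_ne_zero (pentagonalSeries ℤ))
  push_cast
  linear_combination 2 * a * pentagonalSeries ℤ * h2 - 2 * a * f ^ 2 * h1

open Nat.Partition in
theorem dvd_progression_genFun_six :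
    ((24 : ℕ) : ℤ⟦X⟧) ∣ progression 1 (progression 2 (genFun (overlineWeight 6))) ∧
      ((96 : ℕ) : ℤ⟦X⟧) ∣ progression 2 (progression 2 (genFun (overlineWeight 6))) := by
  -- Class 2 is 4 f_2 Ω²/N = 4 φ(-q) f_6⁴/(f_3² N).
  refine mul_dvd_progression_of_mul_thetaNorm (c := 4) four_ne_zero (H := pentagonalSeries ℤ ^ 2)
    (K := expand 2 two_ne_zero (pentagonalSeries ℤ) ^ 4)
    ((isUnit_of_constantCoeff_eq_one constantCoeff_pentagonalSeries).pow 2) ?_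
  have hg := genFun_overlineWeight_mul_theta 6 (by norm_num)
  rw [expand_six_eq] at hg
  rw [(progression_mul_thetaNorm hg).2]
  apply (isUnit_expand_pentagonalSeries 2 two_ne_zero).mul_right_cancel
  have h1 := theta_one_one_mul_expand
  have h2 := congrArg (· ^ 2) theta_one_five_mul_expand
  simp only [expand_six_eq] at h2
  rw [map_pow, map_pow]
  set f := expand 3 three_ne_zero (expand 2 two_ne_zero (pentagonalSeries ℤ))
  push_cast
  linear_combination 4 * h2 - 4 * f ^ 4 * h1

end Congruences

theorem theorem1p1 (n : ℕ) :
    RbarStar 3 (9 * n + 4) ≡ 0 [MOD 12] ∧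
    RbarStar 3 (9 * n + 7) ≡ 0 [MOD 48] ∧
    RbarStar 6 (9 * n + 5) ≡ 0 [MOD 24] ∧
    RbarStar 6 (9 * n + 8) ≡ 0 [MOD 96] := by
  have key {ℓ m r s N : ℕ} (hN : 3 * (3 * n + s) + r = N) (h : (m : ℤ⟦X⟧) ∣
      progression s (progression r (Nat.Partition.genFun (overlineWeight ℓ)))) :
      RbarStar ℓ N ≡ 0 [MOD m] := by
    have := dvd_coeff_of_natCast_dvd h n
    rw [coeff_progression, coeff_progression, coeff_genFun_overlineWeight, hN] at this
    exact Nat.modEq_zero_iff_dvd.mpr (Int.natCast_dvd_natCast.mp this)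
  exact ⟨key (by ring) dvd_progression_genFun_three.1, key (by ring) dvd_progression_genFun_three.2,
    key (by ring) dvd_progression_genFun_six.1, key (by ring) dvd_progression_genFun_six.2⟩
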